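/- **Conventions.** Let $X,Y$ be compact Hausdorff spaces, $Y\neq\emptyset$. $\exp X$ is the space of nonempty closed subsets of $X$ with the Vietoris topology. Let $L$ be a compact (Hausdorff) Lawson lattice: a distributive topological lattice, with bottom $0$ and top $1$, in which every point has a neighbourhood base of join-subsemilattices and one of meet-subsemilattices. For $V\subset L$ let $V{\downarrow}$, $V{\uparrow}$ be the sets of elements below, resp. above, some element of $V$. Write $\beta\ll\alpha$ if every directed $D\subset L$ with $\alpha\le\sup D$ has an element $\gamma\ge\beta$; here $D=\emptyset$ is allowed (with $\sup\emptyset=0$), so that nothing is way below $0$. *Capacities.* An $L$-capacity on $Y$ is a monotone function $c$ from the closed subsets of $Y$ (including $\emptyset$) to $L$ with $c(\emptyset)=0$, $c(Y)=1$, such that for each closed $F$ and each neighbourhood $V$ of $c(F)$ there is an open $U\supset F$ with $c(G)\in V{\downarrow}$ for all closed $G\subset U$. Its subgraph is $\{(B,\alpha)\in\exp Y\times L\mid\alpha\le c(B)\}$. The set $M_LY$ of $L$-capacities is ordered pointwise, and its topology has as a subbase all sets $$O_+(U,V)=\{c\mid \exists F\subset U \text{ closed},\ c(F)\in V{\uparrow}\},\qquad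 O_-(F,V)=\{c\mid c(F)\in V{\downarrow}\}$$ with $U\subset Y$, $V\subset L$ open and $F\subset Y$ closed. A map into $M_LY$ is upper semicontinuous if the preimages of all $O_-(F,V)$ are open, and lower semicontinuous if the preimages of all $O_+(U,V)$ are open. *Representations.* A set $R\subset\exp X\times\exp Y\times L$ is an $L$-ambiguous representation if (a) $(A,B,\alpha)\in R$, $A'\subset A$, $B\subset B'$, $\alpha'\le\alpha$ imply $(A',B',\alpha')\in R$; (b) $(A,B,\alpha),(A,B,\beta)\in R$ imply $(A,B,\alpha\vee\beta)\in R$; (c) $(A,Y,\alpha)\in R$ and $(A,B,0)\in R$ for all $A,B,\alpha$; (d) $AR=\{(B,\alpha)\mid(A,B,\alpha)\in R\}$ is closed in $\exp Y\times L$ for each $A\in\exp X$. It is strict if $RB=\{(A,\alpha)\mid(A,B,\alpha)\in R\}$ is closed in $\exp X\times L$ for each $B\in\exp Y$. For any $R$ let $R^\diamond\subset\exp Y\times\exp X\times L$ be the set of all $(\tilde B,\tilde A,\alpha)$ such that for all $\beta\ll\alpha$ and all $A\in\exp X$ with $A\cap\tilde A=\emptyset$ there is $B\in\exp Y$ with $(A,B,\beta)\in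 R$ and $B\cap\tilde B=\emptyset$. $R$ is pseudo-invertible if $(R^\diamond)^\diamond=R$, and pseudo-invertible off $X$ if $(R^\diamond)^\diamond$ and $R$ contain the same triples $(A,B,\alpha)$ with $A\neq X$. **Proposition.** Let $R\subset\exp X\times\exp Y\times L$. Then $R$ is an $L$-ambiguous representation if and only if for each $A\in\exp X$ the set $AR$ is the subgraph of a (necessarily unique) $L$-capacity $c_{AR}\in M_LY$ and the map $A\mapsto c_{AR}$ from $\exp X$ to $M_LY$ is antitone. In this case this map is * upper semicontinuous if and only if $R$ is strict; * lower semicontinuous if and only if $R$ is pseudo-invertible off $X$; * continuous if and only if $R$ is strict and pseudo-invertible off $X$. Moreover, $R$ is pseudo-invertible if and only if the map is lower semicontinuous and $R$ contains no triple $(X,B,\alpha)$ with $B\neq Y$ and $\alpha\ne0$. -/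

import Mathlib

open Set Topology TopologicalSpace

universe u v w

/-- Topological distributive lattices in which every point has a neighbourhood base of
join-subsemilattices and a neighbourhood base of meet-subsemilattices. -/
class LawsonLattice (L : Type w) [TopologicalSpace L] [DistribLattice L] : Prop
    extends TopologicalLattice L where
  small_sup : ∀ x : L, ∀ U ∈ 𝓝 x, ∃ V ∈ 𝓝 x, V ⊆ U ∧ SupClosed V
  small_inf : ∀ x : L, ∀ U ∈ 𝓝 x, ∃ V ∈ 𝓝 x, V ⊆ U ∧ InfClosed V

/-- The way-below relation. The empty set counts as directed, with supremum the bottom element;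
hence no element is way below the bottom element. For a second argument other than the bottom
element the empty set plays no role. -/
def WayBelow {L : Type w} [PartialOrder L] (a b : L) : Prop :=
  ∀ D : Set L, DirectedOn (· ≤ ·) D → ∀ s, IsLUB D s → b ≤ s → ∃ d ∈ D, a ≤ d

/-- `L`-valued capacities on a compactum `Y`, as functions on all closed subsets of `Y`,
the empty set included. -/
structure LCapacity (Y : Type v) (L : Type w) [TopologicalSpace Y]
    [TopologicalSpace L] [DistribLattice L] [BoundedOrder L] where
  toFun : Closeds Y → L
  map_empty : toFun ⊥ = ⊥
  map_univ : toFun ⊤ = ⊤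
  mono : ∀ F G : Closeds Y, F ≤ G → toFun F ≤ toFun G
  upper : ∀ F : Closeds Y, ∀ V ∈ 𝓝 (toFun F), ∃ U : Set Y, IsOpen U ∧ (F : Set Y) ⊆ U ∧
    ∀ G : Closeds Y, (G : Set Y) ⊆ U → toFun G ∈ lowerClosure V

/-- A nonempty compact subset of a Hausdorff space as a closed subset. -/
def NonemptyCompacts.asCloseds {Y : Type v} [TopologicalSpace Y] [T2Space Y]
    (B : NonemptyCompacts Y) : Closeds Y :=
  ⟨(B : Set Y), B.isCompact.isClosed⟩

namespace LCapacity

section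

variable {Y : Type v} {L : Type w} [TopologicalSpace Y]
  [TopologicalSpace L] [DistribLattice L] [BoundedOrder L]

theorem toFun_injective :
    Function.Injective (LCapacity.toFun : LCapacity Y L → Closeds Y → L) := by
  intro c d h
  cases c
  cases d
  cases h
  rfl

/-- Capacities are ordered pointwise. -/
instance instPartialOrder : PartialOrder (LCapacity Y L) :=
  PartialOrder.lift LCapacity.toFun toFun_injective

/-- The sets `O₊(U, V)` of capacities with `c F ∈ V↑` for some closed `F ⊆ U`. -/
def oPlus (U : Set Y) (V : Set L) : Set (LCapacity Y L) :=
  {c | ∃ F : Closeds Y, (F : Set Y) ⊆ U ∧ c.toFun F ∈ upperClosure V}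

/-- The sets `O₋(F, V)` of capacities with `c F ∈ V↓`. -/
def oMinus (F : Closeds Y) (V : Set L) : Set (LCapacity Y L) :=
  {c | c.toFun F ∈ lowerClosure V}

/-- The topology with subbase all `O₊(U, V)`, where `U` and `V` are open. -/
def plusTopology (Y : Type v) (L : Type w) [TopologicalSpace Y]
    [TopologicalSpace L] [DistribLattice L] [BoundedOrder L] : TopologicalSpace (LCapacity Y L) :=
  generateFrom {O | ∃ U V, IsOpen U ∧ IsOpen V ∧ O = oPlus U V}

/-- The topology with subbase all `O₋(F, V)`, where `F` is closed and `V` is open. -/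
def minusTopology (Y : Type v) (L : Type w) [TopologicalSpace Y]
    [TopologicalSpace L] [DistribLattice L] [BoundedOrder L] : TopologicalSpace (LCapacity Y L) :=
  generateFrom {O | ∃ (F : Closeds Y) (V : Set L), IsOpen V ∧ O = oMinus F V}

/-- The topology on the space of capacities: the subbase consists of all `O₊(U, V)` and all
`O₋(F, V)`. -/
instance instTopologicalSpace : TopologicalSpace (LCapacity Y L) :=
  generateFrom ({O | ∃ U V, IsOpen U ∧ IsOpen V ∧ O = oPlus U V} ∪
    {O | ∃ (F : Closeds Y) (V : Set L), IsOpen V ∧ O = oMinus F V})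

/-- Upper semicontinuity of a capacity-valued map: the sets `{a | f a F ∈ V↓}` are open. -/
def IsUSC {Z : Type u} [TopologicalSpace Z] (f : Z → LCapacity Y L) : Prop :=
  Continuous[inferInstance, minusTopology Y L] f

/-- Lower semicontinuity of a capacity-valued map: the sets
`{a | f a F ∈ V↑ for some closed F ⊆ U}` are open. -/
def IsLSC {Z : Type u} [TopologicalSpace Z] (f : Z → LCapacity Y L) : Prop :=
  Continuous[inferInstance, plusTopology Y L] f

/-- The subgraph of a capacity. -/
def subgraph [T2Space Y] (c : LCapacity Y L) : Set (NonemptyCompacts Y × L) :=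
  {p | p.2 ≤ c.toFun (NonemptyCompacts.asCloseds p.1)}

end

end LCapacity

section

variable {X : Type u} {Y : Type v} {L : Type w} [TopologicalSpace X] [TopologicalSpace Y]

/-- The set `AR`. -/
def sectionAt (R : Set (NonemptyCompacts X × NonemptyCompacts Y × L)) (A : NonemptyCompacts X) :
    Set (NonemptyCompacts Y × L) :=
  {p | (A, p.1, p.2) ∈ R}

/-- The set `RB`. -/
def cosectionAt (R : Set (NonemptyCompacts X × NonemptyCompacts Y × L))
    (B : NonemptyCompacts Y) : Set (NonemptyCompacts X × L) :=
  {p | (p.1, B, p.2) ∈ R}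

/-- The `α`-cut of `R`. -/
def cutAt (R : Set (NonemptyCompacts X × NonemptyCompacts Y × L)) (α : L) :
    Set (NonemptyCompacts X × NonemptyCompacts Y) :=
  {p | (p.1, p.2, α) ∈ R}

/-- `L`-ambiguous representations between `X` and `Y`. -/
structure IsLAmbiguous [CompactSpace Y] [Nonempty Y]
    [TopologicalSpace L] [DistribLattice L] [BoundedOrder L]
    (R : Set (NonemptyCompacts X × NonemptyCompacts Y × L)) : Prop where
  mono : ∀ (A A' : NonemptyCompacts X) (B B' : NonemptyCompacts Y) (α α' : L),
    A' ≤ A → B ≤ B' → α' ≤ α → (A, B, α) ∈ R → (A', B', α') ∈ R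
  sup_mem : ∀ (A : NonemptyCompacts X) (B : NonemptyCompacts Y) (α β : L),
    (A, B, α) ∈ R → (A, B, β) ∈ R → (A, B, α ⊔ β) ∈ R
  top_mem : ∀ (A : NonemptyCompacts X) (α : L), (A, ⊤, α) ∈ R
  bot_mem : ∀ (A : NonemptyCompacts X) (B : NonemptyCompacts Y), (A, B, ⊥) ∈ R
  closed_section : ∀ A : NonemptyCompacts X, IsClosed (sectionAt R A)

/-- Strictness of an `L`-ambiguous representation. -/
def IsStrictRep [TopologicalSpace L]
    (R : Set (NonemptyCompacts X × NonemptyCompacts Y × L)) : Prop :=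
  ∀ B : NonemptyCompacts Y, IsClosed (cosectionAt R B)

/-- The dual `R^⋄` of a crisp relation. -/
def crispDual (R : Set (NonemptyCompacts X × NonemptyCompacts Y)) :
    Set (NonemptyCompacts Y × NonemptyCompacts X) :=
  {p | ∀ A : NonemptyCompacts X, Disjoint (A : Set X) (p.2 : Set X) →
    ∃ B : NonemptyCompacts Y, (A, B) ∈ R ∧ Disjoint (B : Set Y) (p.1 : Set Y)}

/-- The dual `R^⋄`; its `α`-cut is the intersection of the duals of the `β`-cuts of `R` over all
`β` way below `α`. -/
def fuzzyDual [PartialOrder L] (R : Set (NonemptyCompacts X × NonemptyCompacts Y × L)) :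
    Set (NonemptyCompacts Y × NonemptyCompacts X × L) :=
  {p | ∀ β : L, WayBelow β p.2.2 → (p.1, p.2.1) ∈ crispDual (cutAt R β)}

/-- `(R^⋄)^⋄ = R`. -/
def IsPseudoInvertible [PartialOrder L]
    (R : Set (NonemptyCompacts X × NonemptyCompacts Y × L)) : Prop :=
  fuzzyDual (fuzzyDual R) = R

/-- `(R^⋄)^⋄` and `R` contain the same triples `(A, B, α)` with `A ≠ X`. No nonempty set is
disjoint from the whole space, so a triple `(X, B, α)` is in `(R^⋄)^⋄` only for trivial reasons,
whatever `R` is. -/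
def IsPseudoInvertibleOffUniv [PartialOrder L]
    (R : Set (NonemptyCompacts X × NonemptyCompacts Y × L)) : Prop :=
  ∀ (A : NonemptyCompacts X) (B : NonemptyCompacts Y) (α : L), (A : Set X) ≠ univ →
    ((A, B, α) ∈ fuzzyDual (fuzzyDual R) ↔ (A, B, α) ∈ R)

end

/-! ### Compact topological lattices -/

section CompactLattice

variable {L : Type w} [TopologicalSpace L]

/-! For fixed `A` and `B` the admissible grades form a nonempty closed join-closed set, so by
compactness they have a greatest element, the value of the capacity at `B`. `isClosed_hypograph_iff`
equates a closed hypograph with upper semicontinuity. In the variable `B` this gives the regularity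
of the capacity; in the variable `A` it gives "strict iff upper semicontinuous".

Lower semicontinuity is what the double dual encodes. Write `U` and `W` for the complements of `B'`
and `A'`: membership of `(A, B, a)` says that for `b ≪ a` and open `U ⊇ B` some open `W ⊇ A` has the
property that every closed `A₁ ⊆ W` gives each `b' ≪ b` as a grade of some closed `B₁ ⊆ U`. As `c`
is antitone, such `W` suffice to test neighbourhoods of `A`. The Lawson property supplies enough
elements way below a given one (`exists_mem_wayBelow`). Since `A'` must be nonempty, `A = X` is
exceptional. -/

theorem orderClosedTopology_of_continuousInf [T2Space L] [SemilatticeInf L] [ContinuousInf L] :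
    OrderClosedTopology L where
  isClosed_le' := by
    simp_rw [← inf_eq_left]
    exact isClosed_eq (continuous_fst.inf continuous_snd) continuous_fst

theorem isOpen_lowerClosure_of_continuousSup [SemilatticeSup L] [ContinuousSup L] {V : Set L}
    (hV : IsOpen V) : IsOpen (lowerClosure V : Set L) := by
  rw [isOpen_iff_mem_nhds]
  rintro x ⟨v, hv, hxv⟩
  have hcont : Continuous fun y : L => y ⊔ v := continuous_id.sup continuous_const
  filter_upwards [hcont.continuousAt.preimage_mem_nhds
    (hV.mem_nhds (show x ⊔ v ∈ V by rwa [sup_eq_right.2 hxv]))] with y hy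
  exact ⟨y ⊔ v, hy, le_sup_left⟩

theorem isOpen_upperClosure_of_continuousInf [SemilatticeInf L] [ContinuousInf L] {V : Set L}
    (hV : IsOpen V) : IsOpen (upperClosure V : Set L) := by
  rw [isOpen_iff_mem_nhds]
  rintro x ⟨v, hv, hxv⟩
  have hcont : Continuous fun y : L => y ⊓ v := continuous_id.inf continuous_const
  filter_upwards [hcont.continuousAt.preimage_mem_nhds
    (hV.mem_nhds (show x ⊓ v ∈ V by rwa [inf_eq_right.2 hxv]))] with y hy
  exact ⟨y ⊓ v, hy, inf_le_left⟩

/-- By compactness the closures of the tails of `D` have a common point. It bounds `D` because each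
tail lies in a closed `Ici`, and it is least because it lies in `closure D`. -/
theorem DirectedOn.exists_isLUB_mem_closure [PartialOrder L] [OrderClosedTopology L]
    [CompactSpace L] {D : Set L} (hD : DirectedOn (· ≤ ·) D) (hne : D.Nonempty) :
    ∃ x ∈ closure D, IsLUB D x := by
  have : Nonempty D := hne.to_subtype
  obtain ⟨x, hx⟩ := IsCompact.nonempty_iInter_of_directed_nonempty_isCompact_isClosed
    (fun d : D => closure (D ∩ Ici (d : L)))
    (by
      intro a b
      obtain ⟨e, he, hae, hbe⟩ := hD a a.2 b b.2
      exact ⟨⟨e, he⟩, closure_mono (inter_subset_inter_right _ (Ici_subset_Ici.2 hae)),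
        closure_mono (inter_subset_inter_right _ (Ici_subset_Ici.2 hbe))⟩)
    (fun d => ⟨d, subset_closure ⟨d.2, le_rfl⟩⟩)
    (fun d => isClosed_closure.isCompact) (fun d => isClosed_closure)
  rw [mem_iInter] at hx
  obtain ⟨d, hd⟩ := hne
  have hxD : x ∈ closure D := closure_mono inter_subset_left (hx ⟨d, hd⟩)
  refine ⟨x, hxD, fun e he => ?_, fun u hu => ?_⟩
  · exact closure_minimal inter_subset_right isClosed_Ici (hx ⟨e, he⟩)
  · exact closure_minimal (t := Iic u) hu isClosed_Iic hxD

theorem IsClosed.exists_isGreatest_of_supClosed [SemilatticeSup L] [OrderClosedTopology L]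
    [CompactSpace L] {S : Set L} (hS : IsClosed S) (hne : S.Nonempty) (hsup : SupClosed S) :
    ∃ x, IsGreatest S x := by
  obtain ⟨x, hx, hlub⟩ := hsup.directedOn.exists_isLUB_mem_closure hne
  exact ⟨x, hS.closure_eq ▸ hx, hlub.1⟩

theorem IsClosed.exists_isLeast_of_infClosed [SemilatticeInf L] [OrderClosedTopology L]
    [CompactSpace L] {S : Set L} (hS : IsClosed S) (hne : S.Nonempty) (hinf : InfClosed S) :
    ∃ x, IsLeast S x :=
  have : CompactSpace Lᵒᵈ := ‹CompactSpace L›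
  IsClosed.exists_isGreatest_of_supClosed (L := Lᵒᵈ) hS hne hinf

theorem InfClosed.closure_of_continuousInf [SemilatticeInf L] [ContinuousInf L] {S : Set L}
    (hS : InfClosed S) : InfClosed (closure S) := fun _ ha _ hb =>
  map_mem_closure₂ continuous_inf ha hb fun _ ha _ hb => hS ha hb

/-- The hypograph of a map into a compact lattice is closed if and only if the map is upper
semicontinuous. -/
theorem isClosed_hypograph_iff [Lattice L] [TopologicalLattice L] [CompactSpace L] [T2Space L]
    {Z : Type*} [TopologicalSpace Z] {g : Z → L} :
    IsClosed {p : Z × L | p.2 ≤ g p.1} ↔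
      ∀ V : Set L, IsOpen V → IsOpen {z | g z ∈ lowerClosure V} := by
  have := orderClosedTopology_of_continuousInf (L := L)
  constructor
  · intro h V hV
    -- Since `L` is compact, projecting away the grade keeps closed sets closed.
    have hK := isClosedMap_fst_of_compactSpace _ (h.inter
      ((isOpen_lowerClosure_of_continuousSup hV).isClosed_compl.preimage
        (continuous_snd (X := Z))))
    convert hK.isOpen_compl using 1
    ext z
    constructor
    · rintro hz ⟨⟨z, a⟩, ⟨ha, ha'⟩, rfl⟩
      exact ha' ((lowerClosure V).lower ha hz)
    · intro hz
      by_contra hn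
      exact hz ⟨(z, g z), ⟨le_rfl, hn⟩, rfl⟩
  · intro h
    rw [← isOpen_compl_iff, isOpen_iff_mem_nhds]
    rintro ⟨z, a⟩ (hza : ¬ a ≤ g z)
    have hopen : IsOpen {p : L × L | ¬ p.1 ≤ p.2} :=
      (OrderClosedTopology.isClosed_le' (α := L)).isOpen_compl
    obtain ⟨W, V, hW, hV, haW, hgV, hWV⟩ := isOpen_prod_iff.1 hopen a (g z) hza
    filter_upwards [prod_mem_nhds ((h V hV).mem_nhds (subset_lowerClosure hgV))
      (hW.mem_nhds haW)]
    rintro ⟨z', a'⟩ ⟨⟨v, hv, hzv⟩, ha'⟩ (hle : a' ≤ g z')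
    exact hWV (mk_mem_prod ha' hv) (hle.trans hzv)

end CompactLattice

/-! ### The way-below relation in Lawson lattices -/

theorem WayBelow.ne_bot {L : Type w} [PartialOrder L] [OrderBot L] {a b : L} (h : WayBelow b a) :
    a ≠ ⊥ := by
  rintro rfl
  obtain ⟨d, hd, -⟩ := h ∅ (by simp [DirectedOn]) ⊥ isLUB_empty le_rfl
  exact hd

theorem WayBelow.le {L : Type w} [PartialOrder L] {a b : L} (h : WayBelow b a) : b ≤ a := by
  obtain ⟨d, rfl, hd⟩ := h {a} (directedOn_singleton a) a isLUB_singleton le_rfl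
  exact hd

namespace LawsonLattice

variable {L : Type w} [TopologicalSpace L] [CompactSpace L] [T2Space L] [DistribLattice L]
  [LawsonLattice L]

/-- Inside a closed neighbourhood take a meet-closed one; its closure has a least element, which
serves as `b`. -/
theorem exists_mem_Ici_mem_nhds {a : L} {V : Set L} (hV : V ∈ 𝓝 a) :
    ∃ b ∈ V, Ici b ∈ 𝓝 a := by
  have := orderClosedTopology_of_continuousInf (L := L)
  obtain ⟨C, hC, hCc, hCV⟩ := exists_mem_nhds_isClosed_subset hV
  obtain ⟨N, hN, hNC, hinf⟩ := LawsonLattice.small_inf a C hC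
  obtain ⟨b, hb, hle⟩ := isClosed_closure.exists_isLeast_of_infClosed
    ⟨a, subset_closure (mem_of_mem_nhds hN)⟩ hinf.closure_of_continuousInf
  exact ⟨b, hCV (closure_minimal hNC hCc hb),
    Filter.mem_of_superset hN fun x hx => hle (subset_closure hx)⟩

theorem wayBelow_iff [BoundedOrder L] {a b : L} : WayBelow b a ↔ a ≠ ⊥ ∧ Ici b ∈ 𝓝 a := by
  have := orderClosedTopology_of_continuousInf (L := L)
  constructor
  · intro h
    refine ⟨h.ne_bot, ?_⟩
    -- This set is directed with supremum `a`, by `exists_mem_Ici_mem_nhds`.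
    obtain ⟨d, hd, hbd⟩ := h {c | Ici c ∈ 𝓝 a}
      (fun c hc e he => ⟨c ⊔ e, by
        rw [mem_ofPred, ← Ici_inter_Ici]; exact Filter.inter_mem hc he,
        le_sup_left, le_sup_right⟩) a
      ⟨fun c hc => mem_of_mem_nhds hc, fun u hu => by
        by_contra hau
        obtain ⟨c, hc, hca⟩ := exists_mem_Ici_mem_nhds
          ((isClosed_Iic (a := u)).isOpen_compl.mem_nhds hau)
        exact hc (hu hca)⟩ le_rfl
    exact Filter.mem_of_superset hd (Ici_subset_Ici.2 hbd)
  · rintro ⟨ha, hb⟩ D hD s hs has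
    have hne : D.Nonempty := by
      rw [nonempty_iff_ne_empty]
      rintro rfl
      exact ha (le_bot_iff.1 (has.trans (isLUB_empty_iff.1 hs ⊥)))
    obtain ⟨x, hx, hlub⟩ := hD.exists_isLUB_mem_closure hne
    obtain rfl := hlub.unique hs
    have hcont : Continuous fun y : L => y ⊓ a := continuous_id.inf continuous_const
    obtain ⟨d, hd, hdD⟩ := mem_closure_iff_nhds.1 hx _
      (hcont.continuousAt.preimage_mem_nhds (by rwa [inf_eq_right.2 has]))
    exact ⟨d, hdD, le_trans hd inf_le_left⟩

theorem exists_mem_wayBelow [BoundedOrder L] {a : L} (ha : a ≠ ⊥) {V : Set L} (hV : V ∈ 𝓝 a) :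
    ∃ b ∈ V, WayBelow b a := by
  obtain ⟨b, hbV, hb⟩ := exists_mem_Ici_mem_nhds hV
  exact ⟨b, hbV, wayBelow_iff.2 ⟨ha, hb⟩⟩

end LawsonLattice

/-! ### Vietoris neighbourhoods -/

section Vietoris

variable {Y : Type v} [TopologicalSpace Y]

/-- For `G ⊆ ⋃₀ u` the union `B ∪ G` still meets every member of `u`, so it lies in the basic
neighbourhood, and lowerness passes to `G`. The "meets" conditions thus disappear. -/
theorem NonemptyCompacts.exists_isOpen_of_mem_nhds_of_isLowerSet {s : Set (NonemptyCompacts Y)}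
    {B : NonemptyCompacts Y} (hs : s ∈ 𝓝 B) (hlow : IsLowerSet s) :
    ∃ U : Set Y, IsOpen U ∧ (B : Set Y) ⊆ U ∧
      ∀ G : NonemptyCompacts Y, (G : Set Y) ⊆ U → G ∈ s := by
  let := TopologicalSpace.vietoris Y
  rw [NonemptyCompacts.isEmbedding_coe.nhds_eq_comap] at hs
  obtain ⟨t, ht, hts⟩ := hs
  obtain ⟨_, ⟨u, ⟨hu, huo⟩, rfl⟩, ⟨hB, hBu⟩, hut⟩ :=
    vietoris.isTopologicalBasis.mem_nhds_iff.1 ht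
  refine ⟨⋃₀ u, isOpen_sUnion huo, hB, fun G hG => ?_⟩
  have hBG : B ⊔ G ∈ s := by
    refine hts (hut ⟨?_, fun U hU => ?_⟩)
    · rw [NonemptyCompacts.coe_sup]
      exact union_subset hB hG
    · exact (hBu U hU).mono (inter_subset_inter_left _ (by
        rw [NonemptyCompacts.coe_sup]; exact subset_union_left))
  exact hlow le_sup_right hBG

theorem NonemptyCompacts.exists_of_isOpen_compl [CompactSpace Y] {U : Set Y} (hU : IsOpen U)
    (hne : U ≠ univ) : ∃ B : NonemptyCompacts Y, (B : Set Y) = Uᶜ :=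
  ⟨⟨⟨Uᶜ, hU.isClosed_compl.isCompact⟩, nonempty_compl.2 hne⟩, rfl⟩

variable [T2Space Y]

theorem NonemptyCompacts.exists_asCloseds_eq [CompactSpace Y] {F : Closeds Y}
    (hF : (F : Set Y).Nonempty) : ∃ B, NonemptyCompacts.asCloseds B = F :=
  ⟨⟨⟨F, F.isClosed.isCompact⟩, hF⟩, rfl⟩

theorem TopologicalSpace.Closeds.eq_bot_or_exists_asCloseds_eq [CompactSpace Y] (F : Closeds Y) :
    F = ⊥ ∨ ∃ B, NonemptyCompacts.asCloseds B = F := by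
  rcases (F : Set Y).eq_empty_or_nonempty with h | h
  · exact .inl (SetLike.coe_injective (by simpa using h))
  · exact .inr (NonemptyCompacts.exists_asCloseds_eq h)

end Vietoris

/-! ### Semicontinuity and construction of capacities -/

namespace LCapacity

variable {Y : Type v} {L : Type w} [TopologicalSpace Y] [TopologicalSpace L] [DistribLattice L]
  [BoundedOrder L]

theorem isUSC_iff {Z : Type u} [TopologicalSpace Z] {f : Z → LCapacity Y L} :
    IsUSC f ↔ ∀ (F : Closeds Y) (V : Set L), IsOpen V →
      IsOpen {z | (f z).toFun F ∈ lowerClosure V} := by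
  rw [IsUSC, minusTopology, continuous_generateFrom_iff]
  constructor
  · intro h F V hV
    exact h _ ⟨F, V, hV, rfl⟩
  · rintro h _ ⟨F, V, hV, rfl⟩
    exact h F V hV

theorem isLSC_iff {Z : Type u} [TopologicalSpace Z] {f : Z → LCapacity Y L} :
    IsLSC f ↔ ∀ (U : Set Y) (V : Set L), IsOpen U → IsOpen V →
      IsOpen {z | ∃ F : Closeds Y, (F : Set Y) ⊆ U ∧ (f z).toFun F ∈ upperClosure V} := by
  rw [IsLSC, plusTopology, continuous_generateFrom_iff]
  constructor
  · intro h U V hU hV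
    exact h _ ⟨U, V, hU, hV, rfl⟩
  · rintro h _ ⟨U, V, hU, hV, rfl⟩
    exact h U V hU hV

theorem continuous_iff_isLSC_and_isUSC {Z : Type u} [TopologicalSpace Z]
    {f : Z → LCapacity Y L} : Continuous f ↔ IsLSC f ∧ IsUSC f := by
  rw [IsLSC, IsUSC, plusTopology, minusTopology, ← continuous_inf_rng, ← generateFrom_union]

variable [CompactSpace Y] [T2Space Y] [CompactSpace L] [T2Space L] [TopologicalLattice L]

theorem isUSC_iff_isClosed_hypograph {Z : Type u} [TopologicalSpace Z]
    {f : Z → LCapacity Y L} :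
    IsUSC f ↔ ∀ B : NonemptyCompacts Y,
      IsClosed {p : Z × L | p.2 ≤ (f p.1).toFun (NonemptyCompacts.asCloseds B)} := by
  rw [isUSC_iff]
  constructor
  · exact fun h B => isClosed_hypograph_iff.2 (h (NonemptyCompacts.asCloseds B))
  · intro h F V hV
    rcases F.eq_bot_or_exists_asCloseds_eq with rfl | ⟨B, rfl⟩
    · simp only [map_empty, isOpen_const]
    · exact isClosed_hypograph_iff.1 (h B) V hV

omit [CompactSpace Y] in
theorem isClosed_subgraph (c : LCapacity Y L) : IsClosed c.subgraph := by
  refine (isClosed_hypograph_iff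
    (g := fun B => c.toFun (NonemptyCompacts.asCloseds B))).2
    fun V hV => isOpen_iff_mem_nhds.2 fun B hB => ?_
  obtain ⟨U, hU, hBU, hG⟩ := c.upper (NonemptyCompacts.asCloseds B) _
    ((isOpen_lowerClosure_of_continuousSup hV).mem_nhds hB)
  filter_upwards [(NonemptyCompacts.isOpen_subsets_of_isOpen hU).mem_nhds hBU] with G hGU
  obtain ⟨v, hv, hle⟩ := hG (NonemptyCompacts.asCloseds G) hGU
  exact (lowerClosure V).lower hle hv

omit [CompactSpace L] [T2Space L] [TopologicalLattice L] in
theorem ext_asCloseds {c d : LCapacity Y L}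
    (h : ∀ B, c.toFun (NonemptyCompacts.asCloseds B) = d.toFun (NonemptyCompacts.asCloseds B)) :
    c = d := by
  refine toFun_injective (funext fun F => ?_)
  rcases F.eq_bot_or_exists_asCloseds_eq with rfl | ⟨B, rfl⟩
  · rw [c.map_empty, d.map_empty]
  · exact h B

omit [CompactSpace L] [T2Space L] [TopologicalLattice L] in
theorem subgraph_injective :
    Function.Injective (subgraph : LCapacity Y L → Set (NonemptyCompacts Y × L)) := by
  intro c d h
  refine ext_asCloseds fun B => le_antisymm ?_ ?_
  · exact h.le (show (B, c.toFun (NonemptyCompacts.asCloseds B)) ∈ c.subgraph from le_rfl)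
  · exact h.ge (show (B, d.toFun (NonemptyCompacts.asCloseds B)) ∈ d.subgraph from le_rfl)

/-- A monotone function on nonempty closed sets with closed hypograph, taking the value `⊤` at the
whole space, extends to a capacity. -/
theorem exists_of_isClosed_hypograph [Nonempty Y] {g : NonemptyCompacts Y → L} (hg : Monotone g)
    (htop : g ⊤ = ⊤) (hcl : IsClosed {p : NonemptyCompacts Y × L | p.2 ≤ g p.1}) :
    ∃ c : LCapacity Y L, ∀ B, c.toFun (NonemptyCompacts.asCloseds B) = g B := by
  classical
  -- The value `⊥` at the empty set is forced by `map_empty`.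
  let φ : Closeds Y → L := fun F =>
    if h : (F : Set Y).Nonempty then g ⟨⟨F, F.isClosed.isCompact⟩, h⟩ else ⊥
  have hφ : ∀ B, φ (NonemptyCompacts.asCloseds B) = g B := fun B => dif_pos B.nonempty
  have hφ_bot : φ ⊥ = ⊥ := dif_neg (by simp)
  have hφ_mono : ∀ F G : Closeds Y, F ≤ G → φ F ≤ φ G := by
    intro F G hFG
    by_cases hF : (F : Set Y).Nonempty
    · obtain ⟨A, rfl⟩ := NonemptyCompacts.exists_asCloseds_eq hF
      obtain ⟨B, rfl⟩ := NonemptyCompacts.exists_asCloseds_eq (hF.mono hFG)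
      rw [hφ, hφ]
      exact hg hFG
    · exact (dif_neg hF).trans_le bot_le
  refine ⟨⟨φ, hφ_bot, ?_, hφ_mono, fun F V hV => ?_⟩, hφ⟩
  · rw [← htop, ← hφ]
    congr 1
  · rcases F.eq_bot_or_exists_asCloseds_eq with rfl | ⟨B, rfl⟩
    · refine ⟨∅, isOpen_empty, by simp, fun G hG => ?_⟩
      have hG' : G = ⊥ := SetLike.coe_injective (by simpa using hG)
      rw [hG']
      exact subset_lowerClosure (mem_of_mem_nhds hV)
    · rw [hφ] at hV
      obtain ⟨W, hWV, hW, hBW⟩ := mem_nhds_iff.1 hV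
      obtain ⟨U, hU, hBU, hG⟩ := NonemptyCompacts.exists_isOpen_of_mem_nhds_of_isLowerSet
        ((isClosed_hypograph_iff.1 hcl W hW).mem_nhds (subset_lowerClosure hBW))
        (fun B C hCB hB => (lowerClosure W).lower (hg hCB) hB)
      refine ⟨U, hU, hBU, fun G hGU => ?_⟩
      rcases G.eq_bot_or_exists_asCloseds_eq with rfl | ⟨C, rfl⟩
      · rw [hφ_bot]
        exact ⟨_, mem_of_mem_nhds hV, bot_le⟩
      · rw [hφ]
        exact lowerClosure_mono hWV (hG C hGU)

end LCapacity

/-! ### Representations as families of capacities -/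

section Representation

variable {X : Type u} {Y : Type v} {L : Type w} [TopologicalSpace X]
  [TopologicalSpace Y] [CompactSpace Y] [T2Space Y]
  [TopologicalSpace L] [DistribLattice L] [BoundedOrder L]
  {R : Set (NonemptyCompacts X × NonemptyCompacts Y × L)}
  {c : NonemptyCompacts X → LCapacity Y L}

omit [CompactSpace Y] in
theorem mem_iff_le_of_sectionAt_eq (hc : ∀ A, sectionAt R A = (c A).subgraph)
    (A : NonemptyCompacts X) (B : NonemptyCompacts Y) (a : L) :
    (A, B, a) ∈ R ↔ a ≤ (c A).toFun (NonemptyCompacts.asCloseds B) :=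
  Set.ext_iff.1 (hc A) (B, a)

theorem IsLAmbiguous.antitone [Nonempty Y] (hR : IsLAmbiguous R)
    (hc : ∀ A, sectionAt R A = (c A).subgraph) : Antitone c := by
  intro A A' hA F
  rcases F.eq_bot_or_exists_asCloseds_eq with rfl | ⟨B, rfl⟩
  · rw [(c A).map_empty, (c A').map_empty]
  · have h := mem_iff_le_of_sectionAt_eq hc
    exact (h A B _).1 (hR.mono A' A B B _ _ hA le_rfl le_rfl ((h A' B _).2 le_rfl))

variable [CompactSpace L] [T2Space L] [TopologicalLattice L]

theorem isLAmbiguous_of_sectionAt_eq [Nonempty Y] (hc : ∀ A, sectionAt R A = (c A).subgraph)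
    (hanti : Antitone c) : IsLAmbiguous R where
  mono A A' B B' a a' hA hB ha h := by
    rw [mem_iff_le_of_sectionAt_eq hc] at h ⊢
    exact ha.trans (h.trans (((c A).mono _ _ hB).trans (hanti hA _)))
  sup_mem A B a b ha hb := by
    rw [mem_iff_le_of_sectionAt_eq hc] at ha hb ⊢
    exact sup_le ha hb
  top_mem A a := by
    rw [mem_iff_le_of_sectionAt_eq hc]
    refine le_top.trans_eq ((c A).map_univ.symm.trans ?_)
    congr 1
  bot_mem A B := by
    rw [mem_iff_le_of_sectionAt_eq hc]
    exact bot_le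
  closed_section A := by
    rw [hc]
    exact (c A).isClosed_subgraph

theorem IsLAmbiguous.exists_sectionAt_eq [Nonempty Y] (hR : IsLAmbiguous R) :
    ∃ c : NonemptyCompacts X → LCapacity Y L, ∀ A, sectionAt R A = (c A).subgraph := by
  have := orderClosedTopology_of_continuousInf (L := L)
  suffices h : ∀ A, ∃ c : LCapacity Y L, sectionAt R A = c.subgraph from Classical.skolem.1 h
  intro A
  have hgreatest : ∀ B, ∃ x, IsGreatest {a | (A, B, a) ∈ R} x := fun B =>
    ((hR.closed_section A).preimage (.prodMk_right B)).exists_isGreatest_of_supClosed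
      ⟨⊥, hR.bot_mem A B⟩ fun a ha b hb => hR.sup_mem A B a b ha hb
  choose g hg using hgreatest
  have hmem : ∀ B a, (A, B, a) ∈ R ↔ a ≤ g B := fun B a =>
    ⟨fun h => (hg B).2 h, fun h => hR.mono A A B B _ _ le_rfl le_rfl h (hg B).1⟩
  have hsec : sectionAt R A = {p | p.2 ≤ g p.1} := Set.ext fun p => hmem p.1 p.2
  obtain ⟨c, hc⟩ := LCapacity.exists_of_isClosed_hypograph (g := g)
    (fun B B' hB => (hmem _ _).1 (hR.mono A A B B' _ _ le_rfl hB le_rfl (hg B).1))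
    (top_le_iff.1 ((hmem _ _).1 (hR.top_mem A ⊤))) (hsec ▸ hR.closed_section A)
  refine ⟨c, hsec.trans (Set.ext fun p => ?_)⟩
  rw [LCapacity.subgraph, mem_ofPred, mem_ofPred, hc]

theorem isUSC_iff_isStrictRep (hc : ∀ A, sectionAt R A = (c A).subgraph) :
    LCapacity.IsUSC c ↔ IsStrictRep R := by
  rw [LCapacity.isUSC_iff_isClosed_hypograph, IsStrictRep]
  refine forall_congr' fun B => ?_
  rw [show cosectionAt R B = {p | p.2 ≤ (c p.1).toFun (NonemptyCompacts.asCloseds B)} from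
    Set.ext fun p => mem_iff_le_of_sectionAt_eq hc p.1 B p.2]

end Representation

/-! ### The double dual and lower semicontinuity -/

section PseudoInvertible

variable {X : Type u} {Y : Type v} {L : Type w}
  [TopologicalSpace X] [CompactSpace X] [T2Space X]
  [TopologicalSpace Y] [CompactSpace Y] [T2Space Y]
  [TopologicalSpace L] [CompactSpace L] [T2Space L] [DistribLattice L] [BoundedOrder L]
  [LawsonLattice L]
  {R : Set (NonemptyCompacts X × NonemptyCompacts Y × L)}
  {c : NonemptyCompacts X → LCapacity Y L}

omit [CompactSpace X] [T2Space X] [CompactSpace Y] [T2Space Y] [TopologicalSpace L]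
  [CompactSpace L] [T2Space L] [BoundedOrder L] [LawsonLattice L] in
theorem mem_fuzzyDual_fuzzyDual {A : NonemptyCompacts X} {B : NonemptyCompacts Y} {a : L} :
    (A, B, a) ∈ fuzzyDual (fuzzyDual R) ↔
      ∀ b, WayBelow b a → ∀ B' : NonemptyCompacts Y, Disjoint (B' : Set Y) B →
        ∃ A' : NonemptyCompacts X, (∀ b', WayBelow b' b → ∀ A₁ : NonemptyCompacts X,
          Disjoint (A₁ : Set X) A' → ∃ B₁ : NonemptyCompacts Y,
            (A₁, B₁, b') ∈ R ∧ Disjoint (B₁ : Set Y) B') ∧ Disjoint (A' : Set X) A :=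
  Iff.rfl

omit [CompactSpace X] [T2Space X] in
-- This inclusion needs no semicontinuity in `A`: test the double dual with `A₁ = A`, and with `B'`
-- the complement of an open set given by the regularity of `c A`.
theorem mem_of_mem_fuzzyDual_fuzzyDual (hc : ∀ A, sectionAt R A = (c A).subgraph)
    {A : NonemptyCompacts X} {B : NonemptyCompacts Y} {a : L}
    (h : (A, B, a) ∈ fuzzyDual (fuzzyDual R)) : (A, B, a) ∈ R := by
  have := orderClosedTopology_of_continuousInf (L := L)
  have hmem := mem_iff_le_of_sectionAt_eq hc
  rw [hmem]
  set k := (c A).toFun (NonemptyCompacts.asCloseds B)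
  by_contra hak
  have hopen : IsOpen (Iic k)ᶜ := (isClosed_Iic (a := k)).isOpen_compl
  obtain ⟨b, hbk, hba⟩ := LawsonLattice.exists_mem_wayBelow (a := a)
    (by rintro rfl; exact hak bot_le) (hopen.mem_nhds hak)
  obtain ⟨b', hbk', hbb⟩ := LawsonLattice.exists_mem_wayBelow (a := b)
    (by rintro rfl; exact hbk bot_le) (hopen.mem_nhds hbk)
  obtain ⟨U, hU, hBU, hG⟩ := (c A).upper (NonemptyCompacts.asCloseds B) (Ici b')ᶜ
    ((isClosed_Ici (a := b')).isOpen_compl.mem_nhds hbk')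
  have hG' : ∀ G : Closeds Y, (G : Set Y) ⊆ U → ¬ b' ≤ (c A).toFun G := by
    intro G hGU hle
    obtain ⟨v, hv, hGv⟩ := hG G hGU
    exact hv (hle.trans hGv)
  have hUne : U ≠ univ := by
    rintro rfl
    exact hG' ⊤ (subset_univ _) (le_top.trans_eq (c A).map_univ.symm)
  obtain ⟨B', hB'⟩ := NonemptyCompacts.exists_of_isOpen_compl hU hUne
  obtain ⟨A', hA', hdisj⟩ := mem_fuzzyDual_fuzzyDual.1 h b hba B'
    (by rw [hB']; exact disjoint_compl_left.mono_right hBU)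
  obtain ⟨B₁, hB₁, hd⟩ := hA' b' hbb A hdisj.symm
  rw [hB', disjoint_compl_right_iff_subset] at hd
  exact hG' (NonemptyCompacts.asCloseds B₁) hd ((hmem _ _ _).1 hB₁)

theorem mem_fuzzyDual_fuzzyDual_of_isLSC (hc : ∀ A, sectionAt R A = (c A).subgraph)
    (hanti : Antitone c) (hlsc : LCapacity.IsLSC c) {A : NonemptyCompacts X}
    (hA : (A : Set X) ≠ univ) {B : NonemptyCompacts Y} {a : L} (h : (A, B, a) ∈ R) :
    (A, B, a) ∈ fuzzyDual (fuzzyDual R) := by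
  have hmem := mem_iff_le_of_sectionAt_eq hc
  refine mem_fuzzyDual_fuzzyDual.2 fun b hba B' hBB' => ?_
  obtain ⟨V, hVb, hV, haV⟩ := mem_nhds_iff.1 (LawsonLattice.wayBelow_iff.1 hba).2
  have hopen := LCapacity.isLSC_iff.1 hlsc (B' : Set Y)ᶜ V B'.isCompact.isClosed.isOpen_compl hV
  obtain ⟨W, hW, hAW, hWG⟩ := NonemptyCompacts.exists_isOpen_of_mem_nhds_of_isLowerSet
    (hopen.mem_nhds (x := A)
      ⟨NonemptyCompacts.asCloseds B, hBB'.subset_compl_left, a, haV, (hmem _ _ _).1 h⟩)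
    (fun A₁ A₂ hA₂ ⟨F, hF, hFV⟩ => ⟨F, hF, (upperClosure V).upper (hanti hA₂ F) hFV⟩)
  obtain ⟨x, hx⟩ := (ne_univ_iff_exists_notMem _).1 hA
  -- Removing a point `x ∉ A` from `W` makes the complement nonempty even when `W` is all of `X`.
  obtain ⟨A', hA'⟩ := NonemptyCompacts.exists_of_isOpen_compl
    (hW.inter (isClosed_singleton (x := x)).isOpen_compl)
    (fun h => (h.ge (mem_univ x)).2 rfl)
  have hAA' : (A : Set X) ⊆ W ∩ {x}ᶜ :=
    subset_inter hAW (subset_compl_singleton_iff.2 hx)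
  refine ⟨A', fun b' hb' A₁ hA₁ => ?_, by
    rw [hA']; exact disjoint_compl_left.mono_right hAA'⟩
  rw [hA', disjoint_compl_right_iff_subset] at hA₁
  obtain ⟨F, hF, v, hv, hvF⟩ := hWG A₁ (hA₁.trans inter_subset_left)
  have hbF : b ≤ (c A₁).toFun F := (hVb hv).trans hvF
  rcases F.eq_bot_or_exists_asCloseds_eq with rfl | ⟨B₁, rfl⟩
  -- The convention that nothing is way below `⊥` excludes the empty `F`.
  · rw [(c A₁).map_empty, le_bot_iff] at hbF
    exact absurd hbF hb'.ne_bot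
  · exact ⟨B₁, (hmem _ _ _).2 (hb'.le.trans hbF), disjoint_left.2 hF⟩

omit [CompactSpace X] in
theorem isLSC_of_isPseudoInvertibleOffUniv (hc : ∀ A, sectionAt R A = (c A).subgraph)
    (hanti : Antitone c) (hR : IsPseudoInvertibleOffUniv R) : LCapacity.IsLSC c := by
  have hmem := mem_iff_le_of_sectionAt_eq hc
  refine LCapacity.isLSC_iff.2 fun U V hU hV => isOpen_iff_mem_nhds.2 ?_
  rintro A ⟨F, hFU, hFV⟩
  set S := {A | ∃ F : Closeds Y, (F : Set Y) ⊆ U ∧ (c A).toFun F ∈ upperClosure V}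
  have hVo : IsOpen (upperClosure V : Set L) := isOpen_upperClosure_of_continuousInf hV
  by_cases hbot : ⊥ ∈ upperClosure V
  · exact Filter.mem_of_superset Filter.univ_mem fun A' _ =>
      ⟨⊥, by simp, by rwa [(c A').map_empty]⟩
  -- At `A = X` an antitone map is smallest, so lower semicontinuity there is automatic.
  by_cases hA : (A : Set X) = univ
  · exact Filter.mem_of_superset Filter.univ_mem fun A' _ =>
      ⟨F, hFU, (upperClosure V).upper
        (hanti (show (A' : Set X) ⊆ A from hA ▸ subset_univ _) F) hFV⟩
  by_cases hUu : U = univ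
  · exact Filter.mem_of_superset Filter.univ_mem fun A' _ =>
      ⟨⊤, hUu ▸ subset_univ _, by
        rw [(c A').map_univ]
        exact (upperClosure V).upper le_top hFV⟩
  have hFbot : (c A).toFun F ≠ ⊥ := fun h => hbot (h ▸ hFV)
  rcases F.eq_bot_or_exists_asCloseds_eq with rfl | ⟨B, rfl⟩
  · exact absurd (c A).map_empty hFbot
  -- Each of the two duals costs one way-below step, so two successive approximations inside `V↑`
  -- are needed.
  obtain ⟨b, hbV, hb⟩ := LawsonLattice.exists_mem_wayBelow hFbot (hVo.mem_nhds hFV)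
  obtain ⟨b', hbV', hb'⟩ := LawsonLattice.exists_mem_wayBelow (a := b)
    (by rintro rfl; exact hbot hbV) (hVo.mem_nhds hbV)
  obtain ⟨B', hB'⟩ := NonemptyCompacts.exists_of_isOpen_compl hU hUu
  obtain ⟨A', hA', hAA'⟩ := mem_fuzzyDual_fuzzyDual.1 ((hR A B _ hA).2 ((hmem _ _ _).2 le_rfl))
    b hb B' (by rw [hB']; exact disjoint_compl_left.mono_right hFU)
  filter_upwards [(NonemptyCompacts.isOpen_subsets_of_isOpen
    A'.isCompact.isClosed.isOpen_compl).mem_nhds hAA'.subset_compl_left] with A₁ hA₁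
  obtain ⟨B₁, hB₁, hd⟩ := hA' b' hb' A₁ (subset_compl_iff_disjoint_right.1 hA₁)
  rw [hB', disjoint_compl_right_iff_subset] at hd
  exact ⟨NonemptyCompacts.asCloseds B₁, hd,
    (upperClosure V).upper ((hmem _ _ _).1 hB₁) hbV'⟩

theorem isLSC_iff_isPseudoInvertibleOffUniv (hc : ∀ A, sectionAt R A = (c A).subgraph)
    (hanti : Antitone c) : LCapacity.IsLSC c ↔ IsPseudoInvertibleOffUniv R :=
  ⟨fun h _ _ _ hA => ⟨mem_of_mem_fuzzyDual_fuzzyDual hc,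
    mem_fuzzyDual_fuzzyDual_of_isLSC hc hanti h hA⟩,
    isLSC_of_isPseudoInvertibleOffUniv hc hanti⟩

omit [CompactSpace X] [T2Space X] [T2Space Y] in
-- No nonempty `A'` avoids `X`, so the condition can hold only vacuously: either no `B'` avoids `B`
-- or nothing is way below `a`.
theorem mem_fuzzyDual_fuzzyDual_of_eq_univ [Nonempty Y] {A : NonemptyCompacts X}
    (hA : (A : Set X) = univ) {B : NonemptyCompacts Y} {a : L} :
    (A, B, a) ∈ fuzzyDual (fuzzyDual R) ↔ B = ⊤ ∨ a = ⊥ := by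
  rw [mem_fuzzyDual_fuzzyDual]
  constructor
  · intro h
    by_contra! hn
    obtain ⟨b, -, hb⟩ := LawsonLattice.exists_mem_wayBelow hn.2 Filter.univ_mem
    obtain ⟨y, hy⟩ := (ne_univ_iff_exists_notMem (B : Set Y)).1 fun h =>
      hn.1 (NonemptyCompacts.ext (by rw [h, NonemptyCompacts.coe_top]))
    obtain ⟨A', -, hA'⟩ := h b hb {y} (by simpa using hy)
    rw [hA, disjoint_univ] at hA'
    exact A'.nonempty.ne_empty hA'
  · rintro (rfl | rfl) b hb B' hB'
    · rw [NonemptyCompacts.coe_top, disjoint_univ] at hB'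
      exact absurd hB' B'.nonempty.ne_empty
    · exact absurd rfl hb.ne_bot

theorem isPseudoInvertible_iff [Nonempty Y] (hR : IsLAmbiguous R)
    (hc : ∀ A, sectionAt R A = (c A).subgraph) :
    IsPseudoInvertible R ↔ LCapacity.IsLSC c ∧
      ∀ (A : NonemptyCompacts X) (B : NonemptyCompacts Y) (a : L),
        (A : Set X) = univ → (A, B, a) ∈ R → B = ⊤ ∨ a = ⊥ := by
  rw [isLSC_iff_isPseudoInvertibleOffUniv hc (hR.antitone hc), IsPseudoInvertible]
  constructor
  · intro h
    refine ⟨fun A B a _ => by rw [h], fun A B a hA hmem => ?_⟩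
    rwa [← h, mem_fuzzyDual_fuzzyDual_of_eq_univ hA] at hmem
  · rintro ⟨hoff, huniv⟩
    ext ⟨A, B, a⟩
    by_cases hA : (A : Set X) = univ
    · rw [mem_fuzzyDual_fuzzyDual_of_eq_univ hA]
      refine ⟨?_, huniv A B a hA⟩
      rintro (rfl | rfl)
      · exact hR.top_mem A a
      · exact hR.bot_mem A B
    · exact hoff A B a hA

end PseudoInvertible

theorem mainTheorem11 {X : Type u} {Y : Type v} {L : Type w}
    [TopologicalSpace X] [CompactSpace X] [T2Space X]
    [TopologicalSpace Y] [CompactSpace Y] [T2Space Y] [Nonempty Y]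
    [TopologicalSpace L] [CompactSpace L] [T2Space L]
    [DistribLattice L] [BoundedOrder L] [LawsonLattice L]
    (R : Set (NonemptyCompacts X × NonemptyCompacts Y × L)) :
    (IsLAmbiguous R ↔
      ∃! c : NonemptyCompacts X → LCapacity Y L,
        (∀ A, sectionAt R A = (c A).subgraph) ∧ Antitone c) ∧
    (IsLAmbiguous R →
      ∀ c : NonemptyCompacts X → LCapacity Y L,
        (∀ A, sectionAt R A = (c A).subgraph) →
          (LCapacity.IsUSC c ↔ IsStrictRep R) ∧
          (LCapacity.IsLSC c ↔ IsPseudoInvertibleOffUniv R) ∧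
          (Continuous c ↔ IsPseudoInvertibleOffUniv R ∧ IsStrictRep R) ∧
          (IsPseudoInvertible R ↔ LCapacity.IsLSC c ∧
            ∀ (A : NonemptyCompacts X) (B : NonemptyCompacts Y) (α : L),
              (A : Set X) = univ → (A, B, α) ∈ R → B = ⊤ ∨ α = ⊥)) := by
  refine ⟨⟨fun hR => ?_, ?_⟩, fun hR c hc => ⟨isUSC_iff_isStrictRep hc,
    isLSC_iff_isPseudoInvertibleOffUniv hc (hR.antitone hc), ?_, isPseudoInvertible_iff hR hc⟩⟩
  · obtain ⟨c, hc⟩ := hR.exists_sectionAt_eq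
    exact ⟨c, ⟨hc, hR.antitone hc⟩, fun d hd => funext fun A =>
      LCapacity.subgraph_injective ((hd.1 A).symm.trans (hc A))⟩
  · rintro ⟨c, ⟨hc, hanti⟩, -⟩
    exact isLAmbiguous_of_sectionAt_eq hc hanti
  · rw [LCapacity.continuous_iff_isLSC_and_isUSC, isUSC_iff_isStrictRep hc,
      isLSC_iff_isPseudoInvertibleOffUniv hc (hR.antitone hc)]
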